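/- **Setting.** An access point with $N\ge 1$ antennas serves $K$ receivers with $M$ antennas each, in timeslots $l=0,1,2,\dots$. In slot $l$ the channel to receiver $i$ is a random matrix $\mathbf H_i[l]\in\mathbb C^{M\times N}$; the joint channel states $\mathbf H[l]=(\mathbf H_1[l],\dots,\mathbf H_K[l])$ are independent and identically distributed over $l$, with square-integrable entries (as for Rician fading). Put $\mathbf W_i[l]=\mathbf H_i^*[l]\mathbf H_i[l]$. A *policy* is a sequence of random beamforming vectors $\mathbf x[l]\in\mathbb C^N$, where $\mathbf x[l]$ is a measurable function of $\mathbf H[0],\dots,\mathbf H[l]$ and, possibly, of private randomness independent of all the channel states. Its time averages up to $L$ are $$T_L=\frac1L\sum_{l=0}^{L-1}\mathbb E\big[\mathrm{Tr}(\mathbf x[l]\mathbf x^*[l])\big],\qquad R_L=\frac1L\sum_{l=0}^{L-1}\sum_{i=1}^K\mathbb E\big[\mathrm{Tr}(\mathbf W_i[l]\mathbf x[l]\mathbf x^*[l])\big].$$ **Problem (P2).** For given $P_{peak},P_{avg}\ge 0$, let $\bar Q^{Opt}$ be the supremum of $\limsup_{L\to\infty}R_L$ over all policies that satisfy the average transmit-power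 constraint $\limsup_{L\to\infty}T_L\le P_{avg}$ and, almost surely, the peak constraint $\mathrm{Tr}(\mathbf x[l]\mathbf x^*[l])\le P_{peak}$ for all $l\ge0$. **Algorithm 2 (drift-plus-penalty, parameter $V>0$).** Start with $Z[0]=0$. In slot $l$ let $\mathbf W'[l]=V\sum_{i=1}^K\mathbf W_i[l]-Z[l]\mathbf I$. If the largest eigenvalue of $\mathbf W'[l]$ is positive, transmit $\mathbf x[l]=\sqrt{P_{peak}}\,\mathbf u[l]$, where $\mathbf u[l]$ is a unit eigenvector of $\mathbf W'[l]$ for its largest eigenvalue; otherwise $\mathbf x[l]=0$. Then set $Z[l+1]=\max\{Z[l]+\mathrm{Tr}(\mathbf x[l]\mathbf x^*[l])-P_{avg},\,0\}$. The eigenvector may be selected in any way that makes $(\mathbf x[l])_{l\ge 0}$ a policy in the above sense. **Theorem.** Every policy $(\mathbf x[l])_{l\ge0}$ produced by Algorithm 2 (a) satisfies the average transmit-power constraint: $\limsup_{L\to\infty}T_L\le P_{avg}$; (b) has average total received power within $B/V$ of the optimum, where $B=\tfrac12P_{peak}^2$: $$\bar Q^{Opt}-\frac BV\;\le\;\liminf_{L\to\infty}R_L\;\le\;\limsup_{L\to\infty}R_L\;\le\;\bar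 Q^{Opt}.$$ -/

import Mathlib

open MeasureTheory ProbabilityTheory Filter
open scoped Matrix ENNReal

noncomputable section

namespace WPT

/-- The joint channel state of one timeslot: for each of the `K` receivers a complex
`M × N` matrix, its `(m, n)` entry being the gain from antenna `n` of the access point to
antenna `m` of the receiver. -/
abbrev Channel (K M N : ℕ) : Type := Fin K → Fin M → Fin N → ℂ

/-- Beamforming vectors. -/
abbrev Beam (N : ℕ) : Type := Fin N → ℂ

/-- `W_i = H_i^* H_i`. -/
def gram {K M N : ℕ} (h : Channel K M N) (i : Fin K) : Matrix (Fin N) (Fin N) ℂ :=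
  (Matrix.of (h i))ᴴ * Matrix.of (h i)

/-- The transmitted power `Tr(x x^*)`. -/
def txPower {N : ℕ} (x : Beam N) : ℝ :=
  (Matrix.vecMulVec x (star x)).trace.re

/-- The total received power `∑ i, Tr(W_i x x^*)`. -/
def rxPower {K M N : ℕ} (h : Channel K M N) (x : Beam N) : ℝ :=
  ∑ i, (gram h i * Matrix.vecMulVec x (star x)).trace.re

/-- The largest (real) eigenvalue of a square complex matrix; it is used for Hermitian matrices
only, for which the set below is finite, and nonempty when `0 < N`. -/
def maxEigenvalue {N : ℕ} (A : Matrix (Fin N) (Fin N) ℂ) : ℝ :=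
  sSup {t : ℝ | Module.End.HasEigenvalue (Matrix.toLin' A) (t : ℂ)}

/-- The channel states of successive timeslots are independent and identically distributed, with
square-integrable entries. Different receivers and antennas may be dependent. -/
structure IsIIDChannel {Ω : Type*} [MeasurableSpace Ω] (P : Measure Ω) {K M N : ℕ}
    (H : ℕ → Ω → Channel K M N) : Prop where
  measurable : ∀ l, Measurable (H l)
  indep : iIndepFun H P
  ident : ∀ l, IdentDistrib (H l) (H 0) P P
  sq_integrable : ∀ i m n, MemLp (fun ω => H 0 ω i m n) 2 P

/-- The σ-algebra generated by the channel state of timeslot `l`. -/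
abbrev channelSigma {Ω : Type*} {K M N : ℕ} (H : ℕ → Ω → Channel K M N) (l : ℕ) :
    MeasurableSpace Ω :=
  MeasurableSpace.comap (H l) MeasurableSpace.pi

/-- Transmission policies: the beam of timeslot `l` is a (measurable) function of the channel
states of timeslots `0, …, l` and of private randomness, given by a σ-algebra `m` independent of
all channel states. Earlier beams are functions of the same data, so the policy may use them too.
Deterministic policies are the case `m = ⊥`. -/
def IsPolicy {Ω : Type*} [mΩ : MeasurableSpace Ω] (P : Measure Ω) {K M N : ℕ}
    (H : ℕ → Ω → Channel K M N) (x : ℕ → Ω → Beam N) : Prop :=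
  ∃ m : MeasurableSpace Ω, m ≤ mΩ ∧ Indep m (⨆ l, channelSigma H l) P ∧
    ∀ l, Measurable[m ⊔ ⨆ j ≤ l, channelSigma H j] (x l)

/-- `(1/L) ∑_{l < L} E[Tr(x[l] x[l]^*)]`. -/
def avgTx {Ω : Type*} [MeasurableSpace Ω] (P : Measure Ω) {N : ℕ}
    (x : ℕ → Ω → Beam N) (L : ℕ) : ℝ :=
  (1 / (L : ℝ)) * ∑ l ∈ Finset.range L, ∫ ω, txPower (x l ω) ∂P

/-- `(1/L) ∑_{l < L} ∑_i E[Tr(W_i[l] x[l] x[l]^*)]`. -/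
def avgRx {Ω : Type*} [MeasurableSpace Ω] (P : Measure Ω) {K M N : ℕ}
    (H : ℕ → Ω → Channel K M N) (x : ℕ → Ω → Beam N) (L : ℕ) : ℝ :=
  (1 / (L : ℝ)) * ∑ l ∈ Finset.range L, ∫ ω, rxPower (H l ω) (x l ω) ∂P

/-- The average transmit-power constraint: the long-term average is at most `Pavg`. -/
def AvgConstraint {Ω : Type*} [MeasurableSpace Ω] (P : Measure Ω) {N : ℕ} (Pavg : ℝ)
    (x : ℕ → Ω → Beam N) : Prop :=
  limsup (fun L => (avgTx P x L : EReal)) atTop ≤ (Pavg : EReal)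

/-- The peak transmit-power constraint. -/
def PeakConstraint {Ω : Type*} [MeasurableSpace Ω] (P : Measure Ω) {N : ℕ} (Ppeak : ℝ)
    (x : ℕ → Ω → Beam N) : Prop :=
  ∀ᵐ ω ∂P, ∀ l, txPower (x l ω) ≤ Ppeak

/-- The optimal value of the power-limited problem: the supremum of the long-term average total
received power over all policies satisfying both constraints. -/
def optRx {Ω : Type*} [MeasurableSpace Ω] (P : Measure Ω) {K M N : ℕ}
    (H : ℕ → Ω → Channel K M N) (Ppeak Pavg : ℝ) : EReal :=
  sSup {q : EReal | ∃ x : ℕ → Ω → Beam N, IsPolicy P H x ∧ PeakConstraint P Ppeak x ∧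
    AvgConstraint P Pavg x ∧ q = limsup (fun L => (avgRx P H x L : EReal)) atTop}

/-- The virtual queue driven by a sequence of beams:
`Z[0] = 0` and `Z[l+1] = max {Z[l] + Tr(x[l] x[l]^*) - Pavg, 0}`. -/
def queue {N : ℕ} (Pavg : ℝ) (x : ℕ → Beam N) : ℕ → ℝ
  | 0 => 0
  | l + 1 => max (queue Pavg x l + txPower (x l) - Pavg) 0

/-- `W' = V ∑ i, W_i - z I`. -/
def weighted {K M N : ℕ} (V : ℝ) (h : Channel K M N) (z : ℝ) : Matrix (Fin N) (Fin N) ℂ :=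
  (V : ℂ) • ∑ i, gram h i - (z : ℂ) • (1 : Matrix (Fin N) (Fin N) ℂ)

/-- `x` is full-power transmission along a unit eigenvector of `A` for its largest eigenvalue when
that eigenvalue is positive, and `0` otherwise. -/
def IsBeamChoice {N : ℕ} (Ppeak : ℝ) (A : Matrix (Fin N) (Fin N) ℂ) (x : Beam N) : Prop :=
  (0 < maxEigenvalue A ∧ ∃ u : Beam N, star u ⬝ᵥ u = 1 ∧
      A *ᵥ u = (maxEigenvalue A : ℂ) • u ∧ x = (Real.sqrt Ppeak : ℂ) • u) ∨
    (maxEigenvalue A ≤ 0 ∧ x = 0)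

/-- The beams `x` are produced by the drift-plus-penalty algorithm with parameter `V` on the
channel path `h`. The choice among several top eigenvectors is left open. -/
def IsAlgorithmRun {K M N : ℕ} (V Ppeak Pavg : ℝ) (h : ℕ → Channel K M N)
    (x : ℕ → Beam N) : Prop :=
  ∀ l, IsBeamChoice Ppeak (weighted V (h l) (queue Pavg x l)) (x l)

end WPT

end

/-!
The proof compares the algorithm with the Lagrangian dual of the power-limited problem.

Let `λ(h)` be the largest eigenvalue of `∑ i, W_i` (`gain`). Under the peak constraint the maximum
of `V ∑ i, Tr(W_i x x^*) - z Tr(x x^*)` over beams `x` is `Ppeak * max (V λ(h) - z) 0`, and the beam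
chosen by the algorithm attains it at `z = Z[l]` (`IsBeamChoice.txPower_cases`). Let
`D(z) = Ppeak * E[max (V λ(H) - z) 0] + z * Pavg` (`dual`).

* Weak duality: for every policy obeying the two constraints and every constant `z ≥ 0`, integrating
  the pointwise bound slot by slot gives `V Q ≤ D(z)` (`IsIIDChannel.optRx_le_dual`). No stationary
  randomised policy, and no optimality of one, is needed.
* Drift: `Z[l+1]² / 2 - Z[l]² / 2 ≤ Ppeak² / 2 + Z[l] (Tr(x x^*) - Pavg)` (`queue_drift`). Since
  `Z[l]` is a function of the past and of the private randomness, it is independent of `H[l]`, and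
  Fubini's theorem shows that the expected Lagrangian of slot `l` at `Z[l]` is an average of values
  of `D`, hence at least any lower bound of `D` on `[0, ∞)` (`le_integral_rxPower_sub_drift`).
  Summing over `l`, the squares of the queue telescope, which yields the lower bound `le_avgRx` for
  the received power.
* The same sum, with the lower bound `0 ≤ D`, shows `E[Z[L]²] = O(L)`. Hence `E[Z[L]] / L → 0`, and
  the average power constraint holds (`avgConstraint_of_isAlgorithmRun`). The algorithm is therefore
  itself a competitor in the problem, which is the upper bound.
-/

namespace WPT

open scoped ComplexOrder

variable {K M N : ℕ}

/-! ### Transmitted and received power -/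

lemma rxPower_eq_re_dotProduct (h : Channel K M N) (x : Beam N) :
    rxPower h x = (star x ⬝ᵥ ((∑ i, gram h i) *ᵥ x)).re := by
  simp only [rxPower, Matrix.mul_vecMulVec, Matrix.trace_vecMulVec, Matrix.sum_mulVec,
    dotProduct_sum, Complex.re_sum]
  exact Finset.sum_congr rfl fun i _ => by rw [dotProduct_comm]

lemma txPower_eq_sum (x : Beam N) : txPower x = ∑ n, ‖x n‖ ^ 2 := by
  simp [txPower, Matrix.trace_vecMulVec, dotProduct, Complex.mul_conj, Complex.normSq_eq_norm_sq,
    -Complex.ofReal_pow]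

lemma dotProduct_star_self (x : Beam N) : star x ⬝ᵥ x = (txPower x : ℂ) := by
  simp [txPower_eq_sum, dotProduct, Complex.conj_mul']

lemma rxPower_eq_sum (h : Channel K M N) (x : Beam N) :
    rxPower h x = ∑ i, ∑ m, ‖∑ n, h i m n * x n‖ ^ 2 := by
  unfold rxPower
  refine Finset.sum_congr rfl fun i _ => ?_
  rw [← txPower_eq_sum (fun m => ∑ n, h i m n * x n), Matrix.mul_vecMulVec, Matrix.trace_vecMulVec,
    gram, ← Matrix.mulVec_mulVec, dotProduct_comm, Matrix.dotProduct_mulVec,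
    Matrix.vecMul_conjTranspose, star_star, txPower, Matrix.trace_vecMulVec, dotProduct_comm]
  rfl

lemma txPower_nonneg (x : Beam N) : 0 ≤ txPower x := by
  rw [txPower_eq_sum]; positivity

lemma rxPower_nonneg (h : Channel K M N) (x : Beam N) : 0 ≤ rxPower h x := by
  rw [rxPower_eq_sum]; positivity

lemma txPower_smul (c : ℂ) (x : Beam N) : txPower (c • x) = ‖c‖ ^ 2 * txPower x := by
  simp [txPower_eq_sum, mul_pow, Finset.mul_sum]

lemma rxPower_smul (h : Channel K M N) (c : ℂ) (x : Beam N) :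
    rxPower h (c • x) = ‖c‖ ^ 2 * rxPower h x := by
  simp [rxPower_eq_sum, mul_left_comm _ c, ← Finset.mul_sum, mul_pow]

lemma txPower_zero : txPower (0 : Beam N) = 0 := by simp [txPower_eq_sum]

lemma rxPower_zero (h : Channel K M N) : rxPower h 0 = 0 := by simp [rxPower_eq_sum]

lemma txPower_eq_zero {x : Beam N} : txPower x = 0 ↔ x = 0 := by
  rw [txPower_eq_sum, Finset.sum_eq_zero_iff_of_nonneg fun _ _ => by positivity]
  simp [funext_iff]

lemma continuous_txPower : Continuous (txPower : Beam N → ℝ) := by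
  simp only [funext txPower_eq_sum]; fun_prop

lemma continuous_rxPower : Continuous fun p : Channel K M N × Beam N => rxPower p.1 p.2 := by
  simp only [rxPower_eq_sum]; fun_prop

lemma continuous_rxPower_right (h : Channel K M N) : Continuous (rxPower h) := by
  simp only [funext (rxPower_eq_sum h)]; fun_prop

/-- Cauchy–Schwarz, with the Frobenius norm of the channel. -/
lemma rxPower_le_sum_norm_sq (h : Channel K M N) (x : Beam N) :
    rxPower h x ≤ (∑ i, ∑ m, ∑ n, ‖h i m n‖ ^ 2) * txPower x := by
  rw [rxPower_eq_sum, txPower_eq_sum, Finset.sum_mul]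
  refine Finset.sum_le_sum fun i _ => ?_
  rw [Finset.sum_mul]
  refine Finset.sum_le_sum fun m _ => ?_
  calc ‖∑ n, h i m n * x n‖ ^ 2 ≤ (∑ n, ‖h i m n‖ * ‖x n‖) ^ 2 := by
        gcongr; simpa only [norm_mul] using norm_sum_le Finset.univ fun n => h i m n * x n
    _ ≤ _ := Finset.sum_mul_sq_le_sq_mul_sq _ _ _

/-! ### The largest eigenvalue -/

lemma isCompact_txPower_eq_one : IsCompact {u : Beam N | txPower u = 1} := by
  refine Metric.isCompact_of_isClosed_isBounded
    (isClosed_eq continuous_txPower continuous_const) ?_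
  refine (Metric.isBounded_closedBall (x := 0) (r := 1)).subset fun u (hu : txPower u = 1) => ?_
  rw [mem_closedBall_zero_iff, pi_norm_le_iff_of_nonneg zero_le_one]
  intro n
  rw [txPower_eq_sum] at hu
  have := Finset.single_le_sum (f := fun n => ‖u n‖ ^ 2) (fun _ _ => by positivity)
    (Finset.mem_univ n)
  nlinarith [norm_nonneg (u n)]

/-- The largest total received power of a unit-power beam. It is the largest eigenvalue of
`∑ i, W_i`; as a supremum over a fixed compact set it is continuous in the channel. -/
noncomputable def gain (h : Channel K M N) : ℝ :=
  sSup (rxPower h '' {u | txPower u = 1})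

lemma continuous_gain : Continuous (gain : Channel K M N → ℝ) :=
  isCompact_txPower_eq_one.continuous_sSup continuous_rxPower

lemma exists_rxPower_eq_gain (hN : 0 < N) (h : Channel K M N) :
    ∃ u : Beam N, txPower u = 1 ∧ rxPower h u = gain h := by
  have hne : {u : Beam N | txPower u = 1}.Nonempty :=
    ⟨Pi.single ⟨0, hN⟩ 1, by
      simp [txPower_eq_sum, Pi.single_apply, apply_ite]⟩
  obtain ⟨u, hu, hg⟩ :=
    isCompact_txPower_eq_one.exists_sSup_image_eq hne (continuous_rxPower_right h).continuousOn
  exact ⟨u, hu, hg.symm⟩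

lemma rxPower_le_gain_mul (h : Channel K M N) (x : Beam N) :
    rxPower h x ≤ gain h * txPower x := by
  rcases eq_or_ne x 0 with rfl | hx
  · simp [txPower_zero, rxPower_zero]
  have hp : 0 < txPower x := (txPower_nonneg x).lt_of_ne' (txPower_eq_zero.not.2 hx)
  have hn : ‖((Real.sqrt (txPower x))⁻¹ : ℂ)‖ ^ 2 = (txPower x)⁻¹ := by
    rw [norm_inv, Complex.norm_real, inv_pow, Real.norm_eq_abs, sq_abs, Real.sq_sqrt hp.le]
  have := le_csSup (isCompact_txPower_eq_one.image (continuous_rxPower_right h)).bddAbove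
    ⟨((Real.sqrt (txPower x))⁻¹ : ℂ) • x, by
      rw [Set.mem_ofPred, txPower_smul, hn, inv_mul_cancel₀ hp.ne'], rfl⟩
  rw [rxPower_smul, hn, inv_mul_le_iff₀ hp, mul_comm] at this
  exact this

lemma gain_nonneg (h : Channel K M N) : 0 ≤ gain h :=
  Real.sSup_nonneg <| by rintro _ ⟨u, -, rfl⟩; exact rxPower_nonneg h u

lemma gain_le (h : Channel K M N) : gain h ≤ ∑ i, ∑ m, ∑ n, ‖h i m n‖ ^ 2 := by
  refine Real.sSup_le ?_ (by positivity)
  rintro _ ⟨u, hu, rfl⟩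
  simpa [Set.mem_ofPred.1 hu] using rxPower_le_sum_norm_sq h u

lemma isHermitian_sum_gram (h : Channel K M N) : (∑ i, gram h i).IsHermitian := by
  simp [Matrix.IsHermitian, Matrix.conjTranspose_sum, gram]

/-- `gain h • 1 - ∑ i, W_i` is positive semidefinite, so a maximiser of the received power, at which
its quadratic form vanishes, lies in its kernel. -/
lemma sum_gram_mulVec_of_rxPower_eq_gain (h : Channel K M N) {u : Beam N} (hu : txPower u = 1)
    (hg : rxPower h u = gain h) : (∑ i, gram h i) *ᵥ u = (gain h : ℂ) • u := by
  set A := ∑ i, gram h i with hA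
  have hAh : A.IsHermitian := isHermitian_sum_gram h
  have hq : ∀ y : Beam N, star y ⬝ᵥ (((gain h : ℂ) • (1 : Matrix (Fin N) (Fin N) ℂ) - A) *ᵥ y) =
      ((gain h * txPower y - rxPower h y : ℝ) : ℂ) := by
    intro y
    have him := hAh.im_star_dotProduct_mulVec_self y
    rw [Matrix.sub_mulVec, dotProduct_sub, Matrix.smul_mulVec, Matrix.one_mulVec, dotProduct_smul,
      dotProduct_star_self, rxPower_eq_re_dotProduct]
    apply Complex.ext
    · simp [hA]
    · simpa using him
  have hpsd : ((gain h : ℂ) • (1 : Matrix (Fin N) (Fin N) ℂ) - A).PosSemidef := by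
    refine Matrix.PosSemidef.of_dotProduct_mulVec_nonneg ?_ fun y => ?_
    · refine Matrix.IsHermitian.sub ?_ hAh
      simp [Matrix.IsHermitian]
    · rw [hq]
      exact_mod_cast sub_nonneg.2 (rxPower_le_gain_mul h y)
  have := (hpsd.dotProduct_mulVec_zero_iff u).1 (by rw [hq, hu, hg]; simp)
  rw [Matrix.sub_mulVec, Matrix.smul_mulVec, Matrix.one_mulVec, sub_eq_zero] at this
  exact this.symm

lemma weighted_mulVec (V : ℝ) (h : Channel K M N) (z : ℝ) (u : Beam N) :
    weighted V h z *ᵥ u = (V : ℂ) • ((∑ i, gram h i) *ᵥ u) - (z : ℂ) • u := by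
  rw [weighted, Matrix.sub_mulVec, Matrix.smul_mulVec, Matrix.smul_mulVec, Matrix.one_mulVec]

/-- The Rayleigh quotient of an eigenvector is its eigenvalue. -/
lemma mul_rxPower_of_weighted_mulVec {V z t : ℝ} {h : Channel K M N} {u : Beam N}
    (hu : weighted V h z *ᵥ u = (t : ℂ) • u) :
    V * rxPower h u - z * txPower u = t * txPower u := by
  have := congrArg (fun v => (star u ⬝ᵥ v).re) hu
  simp only [weighted_mulVec, dotProduct_sub, dotProduct_smul, dotProduct_star_self] at this
  simpa [rxPower_eq_re_dotProduct] using this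

/-- The largest eigenvalue is continuous in the channel and in the multiplier, which makes it
measurable. -/
lemma maxEigenvalue_weighted (hN : 0 < N) {V : ℝ} (hV : 0 ≤ V) (h : Channel K M N) (z : ℝ) :
    maxEigenvalue (weighted V h z) = V * gain h - z := by
  refine IsGreatest.csSup_eq ⟨?_, ?_⟩
  · obtain ⟨u, hu, hg⟩ := exists_rxPower_eq_gain hN h
    refine Module.End.hasEigenvalue_of_hasEigenvector (x := u)
      ⟨Module.End.mem_eigenspace_iff.2 ?_, ?_⟩
    · rw [Matrix.toLin'_apply, weighted_mulVec, sum_gram_mulVec_of_rxPower_eq_gain h hu hg]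
      push_cast
      rw [sub_smul, smul_smul]
    · rintro rfl
      simp [txPower_zero] at hu
  · intro t ht
    obtain ⟨u, hu⟩ := Module.End.HasEigenvalue.exists_hasEigenvector ht
    have h1 := hu.apply_eq_smul
    rw [Matrix.toLin'_apply] at h1
    have h2 := mul_rxPower_of_weighted_mulVec h1
    have hp : 0 < txPower u := (txPower_nonneg u).lt_of_ne' (txPower_eq_zero.not.2 hu.2)
    have h3 := mul_le_mul_of_nonneg_left (rxPower_le_gain_mul h u) hV
    refine le_of_mul_le_mul_right ?_ hp
    rw [← h2]
    linarith

/-! ### One slot of the algorithm -/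

/-- The chosen beam attains the maximum of `V ∑ i, Tr(W_i x x^*) - z Tr(x x^*)` under the peak
constraint. -/
lemma IsBeamChoice.txPower_cases (hN : 0 < N) {V Ppeak z : ℝ} (hV : 0 ≤ V) (hP : 0 ≤ Ppeak)
    {h : Channel K M N} {x : Beam N} (hx : IsBeamChoice Ppeak (weighted V h z) x) :
    (txPower x = Ppeak ∨ txPower x = 0) ∧
      V * rxPower h x - z * txPower x = Ppeak * max (V * gain h - z) 0 := by
  rw [IsBeamChoice, maxEigenvalue_weighted hN hV] at hx
  rcases hx with ⟨hpos, u, hu, hW, rfl⟩ | ⟨hle, rfl⟩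
  · have hu1 : txPower u = 1 := by
      rw [dotProduct_star_self] at hu; exact_mod_cast hu
    have hs : ‖(Real.sqrt Ppeak : ℂ)‖ ^ 2 = Ppeak := by
      rw [Complex.norm_real, Real.norm_eq_abs, sq_abs, Real.sq_sqrt hP]
    have := mul_rxPower_of_weighted_mulVec hW
    rw [hu1] at this
    rw [txPower_smul, rxPower_smul, hs, hu1, max_eq_left hpos.le]
    exact ⟨Or.inl (mul_one _), by linear_combination Ppeak * this⟩
  · simp [txPower_zero, rxPower_zero, max_eq_right hle]

/-! ### The virtual queue -/

lemma queue_nonneg (Pavg : ℝ) (x : ℕ → Beam N) : ∀ l, 0 ≤ queue Pavg x l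
  | 0 => le_rfl
  | _ + 1 => le_max_right _ _

lemma sum_txPower_le (Pavg : ℝ) (x : ℕ → Beam N) (L : ℕ) :
    ∑ l ∈ Finset.range L, txPower (x l) ≤ L * Pavg + queue Pavg x L := by
  induction L with
  | zero => simp [queue]
  | succ L ih =>
    have : queue Pavg x L + txPower (x L) - Pavg ≤ queue Pavg x (L + 1) := le_max_left _ _
    rw [Finset.sum_range_succ]
    push_cast
    linarith

/-- The queue stays empty when the average-power budget exceeds the peak power. -/
lemma queue_eq_zero {Ppeak Pavg : ℝ} {x : ℕ → Beam N} (hP : Ppeak ≤ Pavg)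
    (hx : ∀ l, txPower (x l) ≤ Ppeak) : ∀ l, queue Pavg x l = 0
  | 0 => rfl
  | l + 1 => by
    rw [queue, queue_eq_zero hP hx l]
    exact max_eq_right (by linarith [hx l])

/-- The drift bound holds with the constant `Ppeak ^ 2 / 2` even if `Ppeak < Pavg`: in that case
`|Tr(x x^*) - Pavg|` may exceed `Ppeak`, but the queue stays empty. -/
lemma queue_drift {Ppeak Pavg : ℝ} (hPavg : 0 ≤ Pavg) {x : ℕ → Beam N}
    (hx : ∀ l, txPower (x l) ≤ Ppeak) (l : ℕ) :
    queue Pavg x (l + 1) ^ 2 / 2 - queue Pavg x l ^ 2 / 2 ≤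
      Ppeak ^ 2 / 2 + queue Pavg x l * (txPower (x l) - Pavg) := by
  rcases le_total Ppeak Pavg with hP | hP
  · rw [queue_eq_zero hP hx, queue_eq_zero hP hx]
    nlinarith [sq_nonneg Ppeak]
  · have h0 := txPower_nonneg (x l)
    have h1 := hx l
    have hsq : (queue Pavg x (l + 1)) ^ 2 ≤ (queue Pavg x l + txPower (x l) - Pavg) ^ 2 := by
      rw [queue]
      rcases max_cases (queue Pavg x l + txPower (x l) - Pavg) 0 with ⟨h, _⟩ | ⟨h, _⟩ <;> rw [h]
      simpa using sq_nonneg _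
    have : (txPower (x l) - Pavg) ^ 2 ≤ Ppeak ^ 2 := by
      apply sq_le_sq'
      · linarith
      · linarith
    nlinarith

lemma queue_le {Ppeak Pavg : ℝ} (hPpeak : 0 ≤ Ppeak) (hPavg : 0 ≤ Pavg) {x : ℕ → Beam N}
    (hx : ∀ l, txPower (x l) ≤ Ppeak) : ∀ l : ℕ, queue Pavg x l ≤ l * Ppeak
  | 0 => by simp [queue]
  | l + 1 => by
    have := queue_le hPpeak hPavg hx l
    refine max_le ?_ (by positivity)
    push_cast
    linarith [hx l]


variable {Ω : Type*} [mΩ : MeasurableSpace Ω] {P : Measure Ω}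

/-! ### Independence of the queue and the current channel -/

/-- If `m₁` is independent of some `m` containing `m₂` and `m₃`, and `m₂` of `m₃`,
then `m₁ ⊔ m₂` is independent of `m₃`. -/
lemma indep_sup_left_of_indep [IsProbabilityMeasure P] {m₁ m₂ m₃ m : MeasurableSpace Ω}
    (h₁ : m₁ ≤ mΩ) (hm : m ≤ mΩ) (h₂ : m₂ ≤ m) (h₃ : m₃ ≤ m) (h : Indep m₁ m P)
    (h' : Indep m₂ m₃ P) : Indep (m₁ ⊔ m₂) m₃ P := by
  set S : Set (Set Ω) :=
    Set.image2 (· ∩ ·) {s | MeasurableSet[m₁] s} {t | MeasurableSet[m₂] t}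
  have hS : IsPiSystem S := by
    rintro _ ⟨s, hs, t, ht, rfl⟩ _ ⟨s', hs', t', ht', rfl⟩ -
    exact ⟨s ∩ s', @MeasurableSet.inter _ m₁ _ _ hs hs', t ∩ t',
      @MeasurableSet.inter _ m₂ _ _ ht ht', Set.inter_inter_inter_comm _ _ _ _⟩
  have hle : m₁ ⊔ m₂ ≤ MeasurableSpace.generateFrom S := by
    refine sup_le (fun s hs => ?_) (fun t ht => ?_)
    · exact MeasurableSpace.measurableSet_generateFrom
        ⟨s, hs, Set.univ, @MeasurableSet.univ _ m₂, Set.inter_univ s⟩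
    · exact MeasurableSpace.measurableSet_generateFrom
        ⟨Set.univ, @MeasurableSet.univ _ m₁, t, ht, Set.univ_inter t⟩
  have hSm : MeasurableSpace.generateFrom S ≤ mΩ := by
    refine MeasurableSpace.generateFrom_le ?_
    rintro _ ⟨s, hs, t, ht, rfl⟩
    exact (h₁ s hs).inter (hm t (h₂ t ht))
  refine indep_of_indep_of_le_left ?_ hle
  refine IndepSets.indep hSm (h₃.trans hm) hS (@MeasurableSpace.isPiSystem_measurableSet _ m₃) rfl
    (@MeasurableSpace.generateFrom_measurableSet _ m₃).symm ?_
  rw [IndepSets_iff]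
  rintro _ u ⟨s, hs, t, ht, rfl⟩ hu
  rw [Indep_iff] at h h'
  rw [Set.inter_assoc, h s (t ∩ u) hs (@MeasurableSet.inter _ m _ _ (h₂ t ht) (h₃ u hu)),
    h' t u ht hu, h s t hs (h₂ t ht), mul_assoc]

lemma measurable_queue {Ω' : Type*} {Pavg : ℝ} {m : MeasurableSpace Ω'}
    {σ : ℕ → MeasurableSpace Ω'} {x : ℕ → Ω' → Beam N}
    (hx : ∀ l, Measurable[m ⊔ ⨆ j ≤ l, σ j] (x l)) (l : ℕ) :
    Measurable[m ⊔ ⨆ j < l, σ j] fun ω => queue Pavg (fun k => x k ω) l := by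
  induction l with
  | zero => exact @measurable_const _ _ _ (_) 0
  | succ l ih =>
    have ih' := ih.mono (sup_le_sup_left (biSup_mono fun j hj => Nat.lt_succ_of_lt hj) m) le_rfl
    have := continuous_txPower.measurable.comp ((hx l).mono
      (sup_le_sup_left (biSup_mono (q := (· < l + 1)) fun j hj => Nat.lt_succ_of_le hj) m) le_rfl)
    exact ((ih'.add this).sub_const Pavg).max measurable_const

lemma IsPolicy.measurable {H : ℕ → Ω → Channel K M N} (hH : ∀ l, Measurable (H l))
    {x : ℕ → Ω → Beam N} (hx : IsPolicy P H x) (l : ℕ) : Measurable (x l) := by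
  obtain ⟨m, hm, -, hxm⟩ := hx
  exact (hxm l).mono (sup_le hm (iSup₂_le fun j _ => (hH j).comap_le)) le_rfl

lemma IsPolicy.indepFun_queue [IsProbabilityMeasure P] {H : ℕ → Ω → Channel K M N}
    (hH : ∀ l, Measurable (H l)) (hind : iIndepFun H P) {x : ℕ → Ω → Beam N}
    (hx : IsPolicy P H x) (Pavg : ℝ) (l : ℕ) :
    IndepFun (fun ω => queue Pavg (fun k => x k ω) l) (H l) P := by
  obtain ⟨m, hm, hmi, hxm⟩ := hx
  have hσ : ∀ j, channelSigma H j ≤ mΩ := fun j => (hH j).comap_le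
  have hpast : Indep (⨆ j ∈ Set.Iio l, channelSigma H j) (⨆ j ∈ ({l} : Set ℕ), channelSigma H j) P :=
    indep_iSup_of_disjoint hσ hind (by simp)
  rw [iSup_singleton] at hpast
  rw [IndepFun_iff_Indep]
  refine indep_of_indep_of_le_left (indep_sup_left_of_indep (mΩ := mΩ) hm (iSup_le hσ)
    (iSup₂_le_iSup _ _) (le_iSup (channelSigma H) l) hmi hpast) ?_
  exact (measurable_queue hxm l).comap_le

/-- For independent `X` and `Y`, a lower bound for the integral over `Y` alone, valid at every value
of `X`, is a lower bound for the joint integral. -/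
lemma le_integral_of_indepFun [IsProbabilityMeasure P] {α β : Type*} [MeasurableSpace α]
    [MeasurableSpace β] {X : Ω → α} {Y : Ω → β} (hX : Measurable X) (hY : Measurable Y)
    (hXY : IndepFun X Y P) {F : α × β → ℝ} (hF : Measurable F)
    (hint : Integrable (fun ω => F (X ω, Y ω)) P) {c : ℝ}
    (h : ∀ ω, c ≤ ∫ ω', F (X ω, Y ω') ∂P) : c ≤ ∫ ω, F (X ω, Y ω) ∂P := by
  have hmap := (indepFun_iff_map_prod_eq_prod_map_map hX.aemeasurable hY.aemeasurable).1 hXY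
  have : IsProbabilityMeasure (P.map X) := Measure.isProbabilityMeasure_map hX.aemeasurable
  have : IsProbabilityMeasure (P.map Y) := Measure.isProbabilityMeasure_map hY.aemeasurable
  have hint' : Integrable F ((P.map X).prod (P.map Y)) := by
    rw [← hmap]
    exact (integrable_map_measure hF.aestronglyMeasurable (hX.prodMk hY).aemeasurable).2 hint
  have heq : ∫ ω, F (X ω, Y ω) ∂P = ∫ a, ∫ b, F (a, b) ∂P.map Y ∂P.map X := by
    rw [← integral_prod _ hint', ← hmap,
      integral_map (hX.prodMk hY).aemeasurable hF.aestronglyMeasurable]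
  have hinner : ∀ a, ∫ b, F (a, b) ∂P.map Y = ∫ ω', F (a, Y ω') ∂P := fun a =>
    integral_map hY.aemeasurable (hF.comp measurable_prodMk_left).aestronglyMeasurable
  have hint'' := hint'.integral_prod_left
  rw [heq, integral_map hX.aemeasurable
    hint''.aestronglyMeasurable]
  have hcomp := (integrable_map_measure hint''.aestronglyMeasurable hX.aemeasurable).1 hint''
  calc c = ∫ _, c ∂P := by simp
    _ ≤ _ := integral_mono (integrable_const c) hcomp fun ω => by
        simpa only [Function.comp_apply, hinner] using h ω

/-! ### Integrability -/

lemma IsIIDChannel.integrable_gain [IsProbabilityMeasure P] {H : ℕ → Ω → Channel K M N}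
    (hH : IsIIDChannel P H) (l : ℕ) : Integrable (fun ω => gain (H l ω)) P := by
  refine ((hH.ident l).comp continuous_gain.measurable).integrable_iff.2 ?_
  have hsum : Integrable (fun ω => ∑ i, ∑ m, ∑ n, ‖H 0 ω i m n‖ ^ 2) P :=
    integrable_finsetSum _ fun i _ => integrable_finsetSum _ fun m _ =>
      integrable_finsetSum _ fun n _ => (hH.sq_integrable i m n).integrable_norm_pow two_ne_zero
  refine hsum.mono' (continuous_gain.measurable.comp (hH.measurable 0)).aestronglyMeasurable ?_
  filter_upwards with ω
  rw [Function.comp_apply, Real.norm_of_nonneg (gain_nonneg _)]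
  exact gain_le _

lemma integrable_txPower [IsFiniteMeasure P] {Ppeak : ℝ} {y : ℕ → Ω → Beam N}
    (hy : ∀ l, Measurable (y l)) (hpeak : PeakConstraint P Ppeak y) (l : ℕ) :
    Integrable (fun ω => txPower (y l ω)) P := by
  refine Integrable.of_bound (continuous_txPower.measurable.comp (hy l)).aestronglyMeasurable
    Ppeak ?_
  filter_upwards [hpeak] with ω hω
  rw [Real.norm_of_nonneg (txPower_nonneg _)]
  exact hω l

lemma IsIIDChannel.integrable_rxPower [IsProbabilityMeasure P] {H : ℕ → Ω → Channel K M N}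
    (hH : IsIIDChannel P H) {Ppeak : ℝ} {y : ℕ → Ω → Beam N}
    (hy : ∀ l, Measurable (y l)) (hpeak : PeakConstraint P Ppeak y) (l : ℕ) :
    Integrable (fun ω => rxPower (H l ω) (y l ω)) P := by
  refine ((hH.integrable_gain l).mul_const Ppeak).mono'
    (continuous_rxPower.measurable.comp ((hH.measurable l).prodMk (hy l))).aestronglyMeasurable ?_
  filter_upwards [hpeak] with ω hω
  rw [Real.norm_of_nonneg (rxPower_nonneg _ _)]
  exact (rxPower_le_gain_mul _ _).trans (mul_le_mul_of_nonneg_left (hω l) (gain_nonneg _))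

lemma IsIIDChannel.integrable_max [IsProbabilityMeasure P] {H : ℕ → Ω → Channel K M N}
    (hH : IsIIDChannel P H) (V z : ℝ) (l : ℕ) :
    Integrable (fun ω => max (V * gain (H l ω) - z) 0) P :=
  (((hH.integrable_gain l).const_mul V).sub (integrable_const z)).pos_part

/-! ### Weak duality -/

/-- The Lagrangian dual function of the power-limited problem, scaled by `V`: the largest expected
value of `V ∑ i, Tr(W_i x x^*) - z (Tr(x x^*) - Pavg)` in one slot under the peak constraint. -/
noncomputable def dual (P : Measure Ω) (H : ℕ → Ω → Channel K M N) (V Ppeak Pavg z : ℝ) : ℝ :=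
  Ppeak * ∫ ω, max (V * gain (H 0 ω) - z) 0 ∂P + z * Pavg

lemma IsIIDChannel.integral_max_eq {H : ℕ → Ω → Channel K M N} (hH : IsIIDChannel P H)
    (V z : ℝ) (l : ℕ) :
    ∫ ω, max (V * gain (H l ω) - z) 0 ∂P = ∫ ω, max (V * gain (H 0 ω) - z) 0 ∂P :=
  ((hH.ident l).comp (u := fun h => max (V * gain h - z) 0)
    (((continuous_gain.const_mul V |>.sub continuous_const).max
      continuous_const).measurable)).integral_eq

lemma IsIIDChannel.mul_integral_rxPower_le [IsProbabilityMeasure P] {H : ℕ → Ω → Channel K M N}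
    (hH : IsIIDChannel P H) {V Ppeak : ℝ} (hV : 0 ≤ V) {y : ℕ → Ω → Beam N}
    (hy : ∀ l, Measurable (y l)) (hpeak : PeakConstraint P Ppeak y) (Pavg z : ℝ) (l : ℕ) :
    V * ∫ ω, rxPower (H l ω) (y l ω) ∂P ≤
      dual P H V Ppeak Pavg z + z * (∫ ω, txPower (y l ω) ∂P - Pavg) := by
  have hi := (hH.integrable_max V z l).const_mul Ppeak
  have ht := (integrable_txPower hy hpeak l).const_mul z
  have := integral_mono_ae ((hH.integrable_rxPower hy hpeak l).const_mul V) (hi.add ht) <| by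
    filter_upwards [hpeak] with ω hω
    have h1 := mul_le_mul_of_nonneg_left (rxPower_le_gain_mul (H l ω) (y l ω)) hV
    have h2 : (V * gain (H l ω) - z) * txPower (y l ω) ≤ max (V * gain (H l ω) - z) 0 * Ppeak :=
      mul_le_mul (le_max_left _ _) (hω l) (txPower_nonneg _) (le_max_right _ _)
    simp only [Pi.add_apply]
    linarith
  simp only [Pi.add_apply] at this
  rw [integral_add hi ht, integral_const_mul, integral_const_mul, integral_const_mul,
    hH.integral_max_eq] at this
  unfold dual
  linarith

lemma IsIIDChannel.mul_avgRx_le [IsProbabilityMeasure P] {H : ℕ → Ω → Channel K M N}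
    (hH : IsIIDChannel P H) {V Ppeak : ℝ} (hV : 0 ≤ V) {y : ℕ → Ω → Beam N}
    (hy : ∀ l, Measurable (y l)) (hpeak : PeakConstraint P Ppeak y) (Pavg z : ℝ) {L : ℕ}
    (hL : 0 < L) :
    V * avgRx P H y L ≤ dual P H V Ppeak Pavg z + z * (avgTx P y L - Pavg) := by
  have hL' : (0 : ℝ) < L := Nat.cast_pos.2 hL
  have := Finset.sum_le_sum fun l (_ : l ∈ Finset.range L) =>
    hH.mul_integral_rxPower_le hV hy hpeak Pavg z l
  rw [Finset.sum_add_distrib, ← Finset.mul_sum, ← Finset.mul_sum, Finset.sum_sub_distrib] at this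
  simp only [Finset.sum_const, Finset.card_range, nsmul_eq_mul] at this
  unfold avgRx avgTx
  refine le_of_mul_le_mul_left ?_ hL'
  field_simp
  linarith

lemma limsup_le_of_le_affine {a b c : ℝ} (hb : 0 ≤ b) {f g : ℕ → ℝ}
    (hfg : ∀ᶠ L in atTop, f L ≤ a + b * g L)
    (hg : limsup (fun L => (g L : EReal)) atTop ≤ (c : EReal)) :
    limsup (fun L => (f L : EReal)) atTop ≤ ((a + b * c : ℝ) : EReal) := by
  refine EReal.le_of_forall_lt_iff_le.1 fun t ht => ?_
  rw [EReal.coe_lt_coe_iff] at ht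
  obtain ⟨ε, hε, hbε⟩ : ∃ ε > 0, b * ε ≤ t - (a + b * c) := by
    refine ⟨(t - (a + b * c)) / (b + 1), div_pos (by linarith) (by linarith), ?_⟩
    rw [mul_div_assoc', div_le_iff₀ (by linarith)]
    nlinarith
  have hlt : limsup (fun L => (g L : EReal)) atTop < ((c + ε : ℝ) : EReal) :=
    hg.trans_lt (EReal.coe_lt_coe_iff.2 (by linarith))
  refine limsup_le_of_le (by isBoundedDefault) ?_
  filter_upwards [hfg, eventually_lt_of_limsup_lt hlt] with L h1 h2
  rw [EReal.coe_lt_coe_iff] at h2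
  rw [EReal.coe_le_coe_iff]
  nlinarith

/-- Weak duality, for arbitrary policies: only the law of each `H[l]` enters, not the way in which
the beams depend on the past. -/
lemma IsIIDChannel.optRx_le_dual [IsProbabilityMeasure P] {H : ℕ → Ω → Channel K M N}
    (hH : IsIIDChannel P H) {V Ppeak Pavg z : ℝ} (hV : 0 < V) (hz : 0 ≤ z) :
    optRx P H Ppeak Pavg ≤ ((dual P H V Ppeak Pavg z / V : ℝ) : EReal) := by
  refine sSup_le ?_
  rintro _ ⟨y, hy, hpeak, havg, rfl⟩
  have := limsup_le_of_le_affine (f := avgRx P H y)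
    (a := dual P H V Ppeak Pavg z / V - z / V * Pavg) (div_nonneg hz hV.le) ?_ havg
  · simpa using this
  · filter_upwards [eventually_gt_atTop 0] with L hL
    have := hH.mul_avgRx_le hV.le (hy.measurable hH.measurable) hpeak Pavg z hL
    rw [← mul_le_mul_iff_right₀ hV]
    refine this.trans_eq ?_
    field_simp
    ring

/-! ### The algorithm -/

lemma peakConstraint_of_isAlgorithmRun {H : ℕ → Ω → Channel K M N} {Ppeak Pavg V : ℝ}
    {x : ℕ → Ω → Beam N} (hN : 0 < N) (hPpeak : 0 ≤ Ppeak) (hV : 0 ≤ V)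
    (hrun : ∀ᵐ ω ∂P, IsAlgorithmRun V Ppeak Pavg (fun l => H l ω) (fun l => x l ω)) :
    PeakConstraint P Ppeak x := by
  filter_upwards [hrun] with ω hω l
  rcases ((hω l).txPower_cases hN hV hPpeak).1 with h | h <;> simp [h, hPpeak]

lemma measurable_queue_of_measurable {Pavg : ℝ} {x : ℕ → Ω → Beam N}
    (hx : ∀ l, Measurable (x l)) (l : ℕ) :
    Measurable fun ω => queue Pavg (fun k => x k ω) l := by
  have := measurable_queue (Pavg := Pavg) (m := mΩ) (σ := fun _ => mΩ) (x := x)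
    (fun l => (hx l).mono le_sup_left le_rfl) l
  exact this.mono (sup_le le_rfl (iSup₂_le fun _ _ => le_rfl)) le_rfl

lemma ae_norm_queue_le {Ppeak Pavg : ℝ} {x : ℕ → Ω → Beam N} (hPpeak : 0 ≤ Ppeak)
    (hPavg : 0 ≤ Pavg) (hpeak : PeakConstraint P Ppeak x) (l : ℕ) :
    ∀ᵐ ω ∂P, ‖queue Pavg (fun k => x k ω) l‖ ≤ l * Ppeak := by
  filter_upwards [hpeak] with ω hω
  rw [Real.norm_of_nonneg (queue_nonneg _ _ _)]
  exact queue_le hPpeak hPavg hω l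

section Algorithm

variable [IsProbabilityMeasure P] {H : ℕ → Ω → Channel K M N} {Ppeak Pavg V : ℝ}
  {x : ℕ → Ω → Beam N}

lemma integrable_queue (hPpeak : 0 ≤ Ppeak) (hPavg : 0 ≤ Pavg) (hx : ∀ l, Measurable (x l))
    (hpeak : PeakConstraint P Ppeak x) (l : ℕ) :
    Integrable (fun ω => queue Pavg (fun k => x k ω) l) P :=
  .of_bound (measurable_queue_of_measurable hx l).aestronglyMeasurable (l * Ppeak)
    (ae_norm_queue_le hPpeak hPavg hpeak l)

lemma integrable_queue_sq (hPpeak : 0 ≤ Ppeak) (hPavg : 0 ≤ Pavg) (hx : ∀ l, Measurable (x l))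
    (hpeak : PeakConstraint P Ppeak x) (l : ℕ) :
    Integrable (fun ω => queue Pavg (fun k => x k ω) l ^ 2) P := by
  simp only [sq]
  exact (integrable_queue hPpeak hPavg hx hpeak l).bdd_mul
    (measurable_queue_of_measurable hx l).aestronglyMeasurable (ae_norm_queue_le hPpeak hPavg hpeak l)

/-- The beam of a slot maximises the Lagrangian of that slot at the multiplier `Z[l]`, so its
drift-plus-penalty is bounded by the value of the Lagrangian. -/
lemma IsAlgorithmRun.drift_le (hN : 0 < N) (hPpeak : 0 ≤ Ppeak) (hPavg : 0 ≤ Pavg) (hV : 0 ≤ V)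
    {h : ℕ → Channel K M N} {u : ℕ → Beam N} (hrun : IsAlgorithmRun V Ppeak Pavg h u) (l : ℕ) :
    Ppeak * max (V * gain (h l) - queue Pavg u l) 0 + queue Pavg u l * Pavg +
        (queue Pavg u (l + 1) ^ 2 / 2 - queue Pavg u l ^ 2 / 2) ≤
      V * rxPower (h l) (u l) + Ppeak ^ 2 / 2 := by
  have hle : ∀ l, txPower (u l) ≤ Ppeak := fun l => by
    rcases ((hrun l).txPower_cases hN hV hPpeak).1 with h | h <;> simp [h, hPpeak]
  have h1 := queue_drift hPavg hle l
  have h2 := ((hrun l).txPower_cases hN hV hPpeak).2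
  linarith

/-- One slot: the queue length, independent of the current channel, may be fixed in the lower
bound `q` for the dual function. -/
lemma le_integral_rxPower_sub_drift (hN : 0 < N) (hH : IsIIDChannel P H) (hPpeak : 0 ≤ Ppeak)
    (hPavg : 0 ≤ Pavg) (hV : 0 < V) (hx : IsPolicy P H x)
    (hrun : ∀ᵐ ω ∂P, IsAlgorithmRun V Ppeak Pavg (fun l => H l ω) (fun l => x l ω)) {q : ℝ}
    (hq : ∀ z, 0 ≤ z → q ≤ dual P H V Ppeak Pavg z) (l : ℕ) :
    q + (∫ ω, queue Pavg (fun k => x k ω) (l + 1) ^ 2 ∂P -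
        ∫ ω, queue Pavg (fun k => x k ω) l ^ 2 ∂P) / 2 ≤
      V * ∫ ω, rxPower (H l ω) (x l ω) ∂P + Ppeak ^ 2 / 2 := by
  have hxm := hx.measurable hH.measurable
  have hpeak := peakConstraint_of_isAlgorithmRun hN hPpeak hV.le hrun
  have hZ := integrable_queue hPpeak hPavg hxm hpeak l
  have hZ2 := integrable_queue_sq hPpeak hPavg hxm hpeak
  set F : ℝ × Channel K M N → ℝ := fun p =>
    Ppeak * max (V * gain p.2 - p.1) 0 + p.1 * Pavg with hF
  have hFm : Measurable F := by
    have := (continuous_gain (K := K) (M := M) (N := N)).measurable.comp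
      (measurable_snd : Measurable (Prod.snd : ℝ × Channel K M N → _))
    exact ((((this.const_mul V).sub measurable_fst).max measurable_const).const_mul Ppeak).add
      (measurable_fst.mul_const Pavg)
  have hFi : Integrable (fun ω => F (queue Pavg (fun k => x k ω) l, H l ω)) P :=
    ((((hH.integrable_gain l).const_mul V).sub hZ).pos_part.const_mul Ppeak).add (hZ.mul_const Pavg)
  have hqF : q ≤ ∫ ω, F (queue Pavg (fun k => x k ω) l, H l ω) ∂P := by
    refine le_integral_of_indepFun (measurable_queue_of_measurable hxm l) (hH.measurable l)
      (hx.indepFun_queue hH.measurable hH.indep Pavg l) hFm hFi fun ω => ?_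
    refine (hq _ (queue_nonneg Pavg (fun k => x k ω) l)).trans_eq ?_
    simp only [hF]
    rw [integral_add ((hH.integrable_max V _ l).const_mul Ppeak) (integrable_const _),
      integral_const_mul, hH.integral_max_eq]
    simp [dual]
  have hd := ((hZ2 (l + 1)).div_const 2).sub ((hZ2 l).div_const 2)
  have hr := (hH.integrable_rxPower hxm hpeak l).const_mul V
  have := integral_mono_ae (hFi.add hd) (hr.add (integrable_const (Ppeak ^ 2 / 2))) <| by
    filter_upwards [hrun] with ω hω
    exact hω.drift_le hN hPpeak hPavg hV.le l
  rw [integral_add' hFi hd, integral_add' hr (integrable_const _), integral_sub' ((hZ2 _).div_const 2)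
    ((hZ2 _).div_const 2), integral_div, integral_div, integral_const_mul] at this
  simp only [integral_const, probReal_univ, one_smul] at this
  linarith

lemma add_integral_queue_sq_le (hN : 0 < N) (hH : IsIIDChannel P H) (hPpeak : 0 ≤ Ppeak)
    (hPavg : 0 ≤ Pavg) (hV : 0 < V) (hx : IsPolicy P H x)
    (hrun : ∀ᵐ ω ∂P, IsAlgorithmRun V Ppeak Pavg (fun l => H l ω) (fun l => x l ω)) {q : ℝ}
    (hq : ∀ z, 0 ≤ z → q ≤ dual P H V Ppeak Pavg z) (L : ℕ) :
    L * q + (∫ ω, queue Pavg (fun k => x k ω) L ^ 2 ∂P) / 2 ≤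
      V * (∑ l ∈ Finset.range L, ∫ ω, rxPower (H l ω) (x l ω) ∂P) + L * (Ppeak ^ 2 / 2) := by
  induction L with
  | zero => simp [queue]
  | succ L ih =>
    have := le_integral_rxPower_sub_drift hN hH hPpeak hPavg hV hx hrun hq L
    rw [Finset.sum_range_succ]
    push_cast
    linarith

/-- The guarantee of the algorithm, already at every finite horizon, against any lower bound for the
dual function. -/
lemma le_avgRx (hN : 0 < N) (hH : IsIIDChannel P H) (hPpeak : 0 ≤ Ppeak)
    (hPavg : 0 ≤ Pavg) (hV : 0 < V) (hx : IsPolicy P H x)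
    (hrun : ∀ᵐ ω ∂P, IsAlgorithmRun V Ppeak Pavg (fun l => H l ω) (fun l => x l ω)) {q : ℝ}
    (hq : ∀ z, 0 ≤ z → q ≤ dual P H V Ppeak Pavg z / V) {L : ℕ} (hL : 0 < L) :
    q - Ppeak ^ 2 / 2 / V ≤ avgRx P H x L := by
  have hL' : (0 : ℝ) < L := Nat.cast_pos.2 hL
  have h := add_integral_queue_sq_le hN hH hPpeak hPavg hV hx hrun (q := V * q)
    (fun z hz => by have := hq z hz; rwa [le_div_iff₀ hV, mul_comm] at this) L
  have h0 : 0 ≤ ∫ ω, queue Pavg (fun k => x k ω) L ^ 2 ∂P :=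
    integral_nonneg fun ω => sq_nonneg _
  rw [avgRx, one_div, ← div_eq_inv_mul, le_div_iff₀ hL']
  refine le_of_mul_le_mul_left ?_ hV
  have : V * ((q - Ppeak ^ 2 / 2 / V) * L) = L * (V * q) - L * (Ppeak ^ 2 / 2) := by
    field_simp
  linarith

/-- The queue grows like `√L` at most: its second moment is linearly bounded, as the received
powers have bounded expectations. -/
lemma exists_integral_queue_sq_le (hN : 0 < N) (hH : IsIIDChannel P H) (hPpeak : 0 ≤ Ppeak)
    (hPavg : 0 ≤ Pavg) (hV : 0 < V) (hx : IsPolicy P H x)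
    (hrun : ∀ᵐ ω ∂P, IsAlgorithmRun V Ppeak Pavg (fun l => H l ω) (fun l => x l ω)) :
    ∃ C : ℝ, ∀ L : ℕ, ∫ ω, queue Pavg (fun k => x k ω) L ^ 2 ∂P ≤ C * L := by
  have hxm := hx.measurable hH.measurable
  have hpeak := peakConstraint_of_isAlgorithmRun hN hPpeak hV.le hrun
  refine ⟨2 * (dual P H V Ppeak Pavg 0 + Ppeak ^ 2 / 2), fun L => ?_⟩
  have h1 := add_integral_queue_sq_le hN hH hPpeak hPavg hV hx hrun (q := 0)
    (fun z hz => add_nonneg (mul_nonneg hPpeak (integral_nonneg fun _ => le_max_right _ _))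
      (mul_nonneg hz hPavg)) L
  have h2 := Finset.sum_le_sum fun l (_ : l ∈ Finset.range L) =>
    hH.mul_integral_rxPower_le hV.le hxm hpeak Pavg 0 l
  rw [← Finset.mul_sum] at h2
  simp only [zero_mul, add_zero, Finset.sum_const, Finset.card_range, nsmul_eq_mul] at h2
  linarith

lemma avgConstraint_of_isAlgorithmRun (hN : 0 < N) (hH : IsIIDChannel P H) (hPpeak : 0 ≤ Ppeak)
    (hPavg : 0 ≤ Pavg) (hV : 0 < V) (hx : IsPolicy P H x)
    (hrun : ∀ᵐ ω ∂P, IsAlgorithmRun V Ppeak Pavg (fun l => H l ω) (fun l => x l ω)) :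
    AvgConstraint P Pavg x := by
  have hxm := hx.measurable hH.measurable
  have hpeak := peakConstraint_of_isAlgorithmRun hN hPpeak hV.le hrun
  obtain ⟨C, hC⟩ := exists_integral_queue_sq_le hN hH hPpeak hPavg hV hx hrun
  have key : ∀ L : ℕ, 0 < L → avgTx P x L ≤ Pavg + (1 + C) / 2 * (Real.sqrt L)⁻¹ := by
    intro L hL
    have hL' : (0 : ℝ) < L := Nat.cast_pos.2 hL
    have hs : 0 < Real.sqrt L := Real.sqrt_pos.2 hL'
    have hss : Real.sqrt L * Real.sqrt L = L := Real.mul_self_sqrt hL'.le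
    have hsum := integrable_finsetSum (Finset.range L) fun l _ => integrable_txPower hxm hpeak l
    have hZ := integrable_queue hPpeak hPavg hxm hpeak L
    have hZ2 := integrable_queue_sq hPpeak hPavg hxm hpeak L
    have h1 := integral_mono hsum ((integrable_const (L * Pavg)).add hZ)
      fun ω => sum_txPower_le Pavg (fun k => x k ω) L
    rw [integral_finsetSum _ fun l _ => integrable_txPower hxm hpeak l,
      integral_add' (integrable_const _) hZ] at h1
    -- `2 a b ≤ a ^ 2 + b ^ 2` with `b = √L`, in place of Jensen's inequality
    have h2 := integral_mono (hZ.const_mul (2 * Real.sqrt L)) (hZ2.add (integrable_const (L : ℝ)))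
      fun ω => by
        have := sq_nonneg (queue Pavg (fun k => x k ω) L - Real.sqrt L)
        simp only [Pi.add_apply]
        linarith
    rw [integral_add' hZ2 (integrable_const _), integral_const_mul] at h2
    simp only [integral_const, probReal_univ, one_smul] at h1 h2
    have h3 := hC L
    have h4 : ∫ ω, queue Pavg (fun k => x k ω) L ∂P ≤ (1 + C) / 2 * Real.sqrt L := by
      refine le_of_mul_le_mul_left ?_ (mul_pos two_pos hs)
      linear_combination h2 + h3 - (1 + C) * hss
    rw [avgTx, one_div, ← div_eq_inv_mul, div_le_iff₀ hL']
    have h5 : (Real.sqrt L)⁻¹ * L = Real.sqrt L := by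
      rw [inv_mul_eq_div, div_eq_iff hs.ne', hss]
    linear_combination h1 + h4 - (1 + C) / 2 * h5
  have hlim : Tendsto (fun L : ℕ => Pavg + (1 + C) / 2 * (Real.sqrt L)⁻¹) atTop (nhds Pavg) := by
    have := (Real.tendsto_sqrt_atTop.comp tendsto_natCast_atTop_atTop).inv_tendsto_atTop
    simpa using (this.const_mul ((1 + C) / 2)).const_add Pavg
  have hlim' := (continuous_coe_real_ereal.tendsto Pavg).comp hlim
  refine (limsup_le_limsup ?_).trans_eq hlim'.limsup_eq
  filter_upwards [eventually_gt_atTop 0] with L hL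
  exact EReal.coe_le_coe_iff.2 (key L hL)

end Algorithm

end WPT

theorem theorem4 {Ω : Type*} [MeasurableSpace Ω] (P : MeasureTheory.Measure Ω)
    [MeasureTheory.IsProbabilityMeasure P]
    {K M N : ℕ} (hN : 0 < N)
    (H : ℕ → Ω → WPT.Channel K M N) (hH : WPT.IsIIDChannel P H)
    (Ppeak Pavg V : ℝ) (hPpeak : 0 ≤ Ppeak) (hPavg : 0 ≤ Pavg) (hV : 0 < V)
    (x : ℕ → Ω → WPT.Beam N) (hx : WPT.IsPolicy P H x)
    (hrun : ∀ᵐ ω ∂P, WPT.IsAlgorithmRun V Ppeak Pavg (fun l => H l ω) (fun l => x l ω)) :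
    WPT.AvgConstraint P Pavg x ∧
    WPT.optRx P H Ppeak Pavg - ((Ppeak ^ 2 / 2 / V : ℝ) : EReal) ≤
      Filter.liminf (fun L => (WPT.avgRx P H x L : EReal)) Filter.atTop ∧
    Filter.limsup (fun L => (WPT.avgRx P H x L : EReal)) Filter.atTop ≤
      WPT.optRx P H Ppeak Pavg := by
  have havg := WPT.avgConstraint_of_isAlgorithmRun hN hH hPpeak hPavg hV hx hrun
  refine ⟨havg, ?_, le_sSup ⟨x, hx,
    WPT.peakConstraint_of_isAlgorithmRun hN hPpeak hV.le hrun, havg, rfl⟩⟩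
  have hdual : ∀ z : ℝ, 0 ≤ z → WPT.optRx P H Ppeak Pavg ≤ _ :=
    fun z hz => hH.optRx_le_dual (V := V) hV hz
  generalize WPT.optRx P H Ppeak Pavg = Q at hdual
  induction Q with
  | bot => simp
  | top => simpa using hdual 0 le_rfl
  | coe q =>
    refine le_liminf_of_le (by isBoundedDefault) ?_
    filter_upwards [eventually_gt_atTop 0] with L hL
    exact_mod_cast WPT.le_avgRx hN hH hPpeak hPavg hV hx hrun
      (fun z hz => EReal.coe_le_coe_iff.1 (hdual z hz)) hL
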